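/- Let $k$ be a field of characteristic different from $2$ and $3$, let $\Gamma$ be a commutative group, and let $\varepsilon:\Gamma\times\Gamma\to k\setminus\{0\}$ be a commutation factor, i.e. $\varepsilon(\alpha+\beta,\gamma)=\varepsilon(\alpha,\gamma)\varepsilon(\beta,\gamma)$, $\varepsilon(\alpha,\beta+\gamma)=\varepsilon(\alpha,\beta)\varepsilon(\alpha,\gamma)$ and $\varepsilon(\alpha,\beta)\varepsilon(\beta,\alpha)=1$. Let $g=\bigoplus_{\gamma\in\Gamma}g_\gamma$ be an $n$-dimensional abelian color Lie algebra (a $\Gamma$-graded $\varepsilon$-Lie algebra with zero bracket). Let $A=U(g)$ be its universal enveloping algebra, i.e. the quotient of the tensor algebra $T(g)$ by the relations $ab=\varepsilon(\alpha,\beta)ba$ for $a\in g_\alpha$, $b\in g_\beta$, and let $A_i\subseteq A$ be the span of the products of $i$ elements of $g$. Definitions. A graded $k$-algebra $R=\bigoplus_{i\ge0}R_i$ is standard if $R_0=k$, every $R_i$ is finite-dimensional, and $R$ is generated by $R_1$ as a unital algebra; put $R_+=\bigoplus_{i\ge1}R_i$. For $x\in R$ and a right ideal $J$ put $(x:J)=\{a\in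 R\mid xa\in J\}$. A Koszul filtration in $R$ is a set $\mathbf F$ of right ideals, each generated by elements of $R_1$, such that $0,R_+\in\mathbf F$ and for every $0\neq I\in\mathbf F$ there are $J\in\mathbf F$, $J\ne I$, and $x\in R_1$ with $I=J+xR$ and $(x:J)\in\mathbf F$. A Groebner flag is a Koszul filtration that is a complete flag $0=I_0\subset I_1\subset\dots\subset I_m=R_+$ (strict inclusions, $m=\dim R_1$). A standard algebra is initially Koszul if it has a Groebner flag; it is initially Koszul with respect to a basis $x_1,\dots,x_m$ of $R_1$ if the right ideals $I_i=x_1R+\dots+x_iR$, $0\le i\le m$, form a Groebner flag. It is strongly Koszul if $R_1$ has a basis $X$ such that for every $Y\subseteq X$ and every $x\in X\setminus Y$ the right ideal $(x:YR)$ is generated by a subset of $X$. Proposition. With the grading $(A_i)_{i\ge 0}$, $A=U(g)$ is a standard graded algebra, and: 1. $A$ is initially Koszul, i.e. it has a Groebner flag. 2. For every sequence $x_1,\dots,x_n$ of $\Gamma$-homogeneous elements spanning $g$ (equivalently, every $\Gamma$-homogeneous basis of $g$ in any order), the images of $x_1,\dots,x_n$ in $A$ form a basis of $A_1$, and $A$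 is initially Koszul with respect to it. (This is the sense in which $A$ is universally initially Koszul.) 3. $A$ is strongly Koszul. -/

import Mathlib

namespace ColorKoszul

/-! ### Koszul filtrations and Groebner flags in graded associative algebras -/

section Graded

/-- Right ideals of a ring `R`. -/
abbrev RightIdeal (R : Type*) [Ring R] := Submodule Rᵐᵒᵖ R

/-- The right ideal generated by a set. -/
abbrev rightSpan {R : Type*} [Ring R] (S : Set R) : RightIdeal R := Submodule.span Rᵐᵒᵖ S

/-- The right ideal `(x : J) = {a ∈ R | x a ∈ J}`. -/
def rightColon {R : Type*} [Ring R] (x : R) (J : RightIdeal R) : RightIdeal R where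
  carrier := {a | x * a ∈ J}
  add_mem' := by
    intro a b ha hb
    simpa [mul_add] using J.add_mem ha hb
  zero_mem' := by simp
  smul_mem' := by
    intro c a ha
    have h := J.smul_mem c ha
    simpa [MulOpposite.smul_eq_mul_unop, mul_assoc] using h

variable {k R : Type*} [Field k] [Ring R] [Algebra k R]

/-- The family `𝒜` is a grading `R = ⨁ 𝒜 i` that makes `R` a standard algebra: all components are
finite-dimensional, `𝒜 0 = k`, and `R` is generated as a unital algebra by `𝒜 1`. -/
structure IsStandardGraded (𝒜 : ℕ → Submodule k R) : Prop where
  gradedMonoid : SetLike.GradedMonoid 𝒜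
  isInternal : DirectSum.IsInternal 𝒜
  finite : ∀ i, Module.Finite k (𝒜 i)
  nontrivial : Nontrivial R
  zero_eq : 𝒜 0 = LinearMap.range (Algebra.linearMap k R)
  adjoin_one : Algebra.adjoin k (𝒜 1 : Set R) = ⊤

/-- The augmentation ideal `R_+ = 𝒜 1 ⊕ 𝒜 2 ⊕ …`, as a right ideal. -/
def augmentationIdeal (𝒜 : ℕ → Submodule k R) : RightIdeal R :=
  rightSpan (⋃ i : ℕ, (𝒜 (i + 1) : Set R))

/-- A Koszul filtration: a set `F` of right ideals generated in degree one, containing `0` and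
`R_+`, such that every nonzero `I ∈ F` is `J + xR` for some `J ∈ F`, `J ≠ I`, and some `x` of
degree one with `(x : J) ∈ F`. -/
structure IsKoszulFiltration (𝒜 : ℕ → Submodule k R) (F : Set (RightIdeal R)) : Prop where
  degree_one_generated : ∀ I ∈ F, ∃ S : Set R, S ⊆ 𝒜 1 ∧ I = rightSpan S
  bot_mem : ⊥ ∈ F
  augmentation_mem : augmentationIdeal 𝒜 ∈ F
  step : ∀ I ∈ F, I ≠ ⊥ → ∃ J ∈ F, I ≠ J ∧ ∃ x ∈ 𝒜 1,
    I = J ⊔ rightSpan {x} ∧ rightColon x J ∈ F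

/-- A Groebner flag: a complete flag `0 = I₀ ⊂ I₁ ⊂ … ⊂ Iₙ = R_+`, with `n = dim 𝒜 1`, of right
ideals whose members form a Koszul filtration. -/
structure IsGroebnerFlag (𝒜 : ℕ → Submodule k R) {n : ℕ} (I : Fin (n + 1) → RightIdeal R) :
    Prop where
  finrank_eq : Module.finrank k (𝒜 1) = n
  strictMono : StrictMono I
  zero_eq : I 0 = ⊥
  last_eq : I (Fin.last n) = augmentationIdeal 𝒜
  isKoszulFiltration : IsKoszulFiltration 𝒜 (Set.range I)

/-- A standard algebra is initially Koszul if it has a Groebner flag. -/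
def IsInitiallyKoszul (𝒜 : ℕ → Submodule k R) : Prop :=
  IsStandardGraded 𝒜 ∧ ∃ (n : ℕ) (I : Fin (n + 1) → RightIdeal R), IsGroebnerFlag 𝒜 I

/-- The finite sequence `x` is a vector space basis of the component `𝒜 1`. -/
def IsDegreeOneBasis (𝒜 : ℕ → Submodule k R) {n : ℕ} (x : Fin n → R) : Prop :=
  LinearIndependent k x ∧ Submodule.span k (Set.range x) = 𝒜 1

/-- The right ideals `Iᵢ = x₁R + … + xᵢR`, for `0 ≤ i ≤ n`. -/
def flagOf {n : ℕ} (x : Fin n → R) (i : Fin (n + 1)) : RightIdeal R :=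
  rightSpan (x '' {j | (j : ℕ) < i})

/-- A standard algebra is initially Koszul with respect to a basis `x₁, …, xₙ` of its degree one
component if the right ideals `x₁R + … + xᵢR` form a Groebner flag. -/
def IsInitiallyKoszulWRT (𝒜 : ℕ → Submodule k R) {n : ℕ} (x : Fin n → R) : Prop :=
  IsStandardGraded 𝒜 ∧ IsDegreeOneBasis 𝒜 x ∧ IsGroebnerFlag 𝒜 (flagOf x)

/-- A standard algebra is strongly Koszul if its degree one component has a basis `x₁, …, xₙ`
such that, for every subset `Y` of it and every `xⱼ ∉ Y`, the right ideal `(xⱼ : YR)` is generated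
by a subset of `{x₁, …, xₙ}`. -/
def IsStronglyKoszul (𝒜 : ℕ → Submodule k R) : Prop :=
  IsStandardGraded 𝒜 ∧ ∃ (n : ℕ) (x : Fin n → R), IsDegreeOneBasis 𝒜 x ∧
    ∀ (Y : Set (Fin n)) (j : Fin n), j ∉ Y →
      ∃ Z : Set (Fin n), rightColon (x j) (rightSpan (x '' Y)) = rightSpan (x '' Z)

end Graded

/-! ### Color Lie algebras and their universal enveloping algebras -/

/-- A commutation factor on the commutative group `Γ` with values in `k \ {0}`. -/
structure CommutationFactor (k Γ : Type*) [Field k] [AddCommGroup Γ] where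
  toFun : Γ → Γ → kˣ
  add_left : ∀ α β γ, toFun (α + β) γ = toFun α γ * toFun β γ
  add_right : ∀ α β γ, toFun α (β + γ) = toFun α β * toFun α γ
  mul_swap : ∀ α β, toFun α β * toFun β α = 1

instance {k Γ : Type*} [Field k] [AddCommGroup Γ] :
    CoeFun (CommutationFactor k Γ) (fun _ => Γ → Γ → kˣ) := ⟨CommutationFactor.toFun⟩

/-- The structure of a `Γ`-graded `ε`-Lie algebra (a color Lie algebra) on the vector space `g`:
a direct sum decomposition of `g` into homogeneous components and a bilinear bracket. -/
structure ColorLieAlgebra {k Γ : Type*} [Field k] [AddCommGroup Γ] (ε : CommutationFactor k Γ)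
    (g : Type*) [AddCommGroup g] [Module k g] where
  component : Γ → Submodule k g
  independent : iSupIndep component
  iSup_eq_top : ⨆ γ, component γ = ⊤
  bracket : g →ₗ[k] g →ₗ[k] g
  bracket_mem : ∀ α β, ∀ a ∈ component α, ∀ b ∈ component β, bracket a b ∈ component (α + β)
  skew : ∀ α β, ∀ a ∈ component α, ∀ b ∈ component β,
    bracket a b = -((ε α β : k) • bracket b a)
  jacobi : ∀ α β γ, ∀ a ∈ component α, ∀ b ∈ component β, ∀ c ∈ component γ,
    (ε γ α : k) • bracket a (bracket b c) + (ε β γ : k) • bracket c (bracket a b)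
      + (ε α β : k) • bracket b (bracket c a) = 0

namespace ColorLieAlgebra

variable {k Γ : Type*} [Field k] [AddCommGroup Γ] {ε : CommutationFactor k Γ}
  {g : Type*} [AddCommGroup g] [Module k g]

/-- A color Lie algebra is abelian if its bracket vanishes. -/
def IsAbelian (L : ColorLieAlgebra ε g) : Prop := ∀ a b : g, L.bracket a b = 0

/-- An element is homogeneous if it lies in some component. -/
def IsHomogeneous (L : ColorLieAlgebra ε g) (a : g) : Prop := ∃ γ, a ∈ L.component γ

/-- The defining relations `ab - ε(α, β) ba = ⟨a, b⟩`, for `a` of degree `α` and `b` of degree `β`,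
of the universal enveloping algebra as a quotient of the tensor algebra of `g`. -/
inductive EnvelopingRel (L : ColorLieAlgebra ε g) : TensorAlgebra k g → TensorAlgebra k g → Prop
  | bracket (α β : Γ) (a b : g) (ha : a ∈ L.component α) (hb : b ∈ L.component β) :
      EnvelopingRel L
        (TensorAlgebra.ι k a * TensorAlgebra.ι k b
          - (ε α β : k) • (TensorAlgebra.ι k b * TensorAlgebra.ι k a))
        (TensorAlgebra.ι k (L.bracket a b))

/-- The universal enveloping algebra `U(g)`. -/
abbrev Enveloping (L : ColorLieAlgebra ε g) := RingQuot L.EnvelopingRel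

/-- The canonical map `g → U(g)`. -/
def ι (L : ColorLieAlgebra ε g) : g →ₗ[k] L.Enveloping :=
  (RingQuot.mkAlgHom k L.EnvelopingRel).toLinearMap ∘ₗ TensorAlgebra.ι k

/-- The subspace of `U(g)` spanned by the products of `i` elements of `g`. When `g` is abelian, the
defining relations are homogeneous and these are the components of the degree grading of `U(g)`. -/
def degreePart (L : ColorLieAlgebra ε g) (i : ℕ) : Submodule k L.Enveloping :=
  LinearMap.range L.ι ^ i

end ColorLieAlgebra

end ColorKoszul

/-!
For a homogeneous basis `x₁, …, xₙ` of an abelian `g`, the algebra `R = U(g)` is presented by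
the relations `xᵢ xⱼ = qᵢⱼ xⱼ xᵢ` with `qᵢⱼ = ε(dᵢ, dⱼ)`, where `dᵢ` is the degree of `xᵢ`. Hence,
for every set `Y` of generators, the right ideal `Y R` is two-sided and is the kernel of the
endomorphism that kills `Y` and fixes the other generators, and `(xⱼ : Y R)` is determined by the
annihilator of `xⱼ`. The latter comes from a linear map `D` with `D (xⱼ b) = b + c xⱼ (D b)`, the
lower left entry of a homomorphism from `R` to triangular `2 × 2` matrices. If `qⱼⱼ = 1`, then
`c = 0` is possible, so `xⱼ` is left regular and `(xⱼ : Y R) = Y R`. Otherwise `xⱼ² = 0`, and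
`c = -1` shows that `xⱼ b = 0` only for `b = xⱼ (D b)`, so `(xⱼ : Y R)` is generated by `Y ∪ {xⱼ}`.
All these colon ideals are generated by subsets of the basis, and if `Y = {x₁, …, xⱼ₋₁}` they
belong to the flag.
-/

namespace ColorKoszul

section RightIdeal

variable {R : Type*} [Ring R]

theorem RightIdeal.mul_mem_right {J : RightIdeal R} {a : R} (ha : a ∈ J) (b : R) : a * b ∈ J := by
  simpa only [MulOpposite.smul_eq_mul_unop, MulOpposite.unop_op] using
    J.smul_mem (MulOpposite.op b) ha

theorem mem_rightColon {x a : R} {J : RightIdeal R} : a ∈ rightColon x J ↔ x * a ∈ J :=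
  Iff.rfl

variable {k : Type*} [CommRing k] [Algebra k R]

theorem RightIdeal.algebra_smul_mem {J : RightIdeal R} (c : k) {a : R} (ha : a ∈ J) :
    c • a ∈ J := by
  rw [← mul_one a, ← mul_smul_comm]
  exact J.mul_mem_right ha _

theorem coe_span_subset_rightSpan (S : Set R) : (Submodule.span k S : Set R) ⊆ rightSpan S := by
  intro a ha
  induction ha using Submodule.span_induction with
  | mem s hs => exact Submodule.subset_span hs
  | zero => exact zero_mem _
  | add a b _ _ ha hb => exact add_mem ha hb
  | smul c a _ ha => exact RightIdeal.algebra_smul_mem c ha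

end RightIdeal

section Flag

variable {k R : Type*} [Field k] [Ring R] [Algebra k R] {n : ℕ}

theorem augmentationIdeal_pow_span (S : Set R) :
    augmentationIdeal (fun i => Submodule.span k S ^ i) = rightSpan S := by
  apply le_antisymm
  · refine Submodule.span_le.mpr (Set.iUnion_subset fun i a ha => ?_)
    simp only [pow_succ', SetLike.mem_coe] at ha
    refine Submodule.mul_induction_on ha (fun v hv b _ => ?_) fun a b ha hb => add_mem ha hb
    exact RightIdeal.mul_mem_right (coe_span_subset_rightSpan S hv) b
  · refine Submodule.span_mono fun s hs => Set.mem_iUnion.mpr ⟨0, ?_⟩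
    simpa only [zero_add, pow_one] using Submodule.subset_span hs

theorem setOf_lt_succ (i : Fin n) :
    {j : Fin n | (j : ℕ) < i.succ} = insert i {j : Fin n | (j : ℕ) < i.castSucc} := by
  ext j
  simp only [Set.mem_ofPred_eq, Set.mem_insert_iff, Fin.val_succ, Fin.val_castSucc, Fin.ext_iff]
  omega

theorem flagOf_zero (x : Fin n → R) : flagOf x 0 = ⊥ := by
  simp [flagOf]

theorem flagOf_last (x : Fin n → R) : flagOf x (Fin.last n) = rightSpan (Set.range x) := by
  simp [flagOf]

theorem flagOf_succ (x : Fin n → R) (i : Fin n) :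
    flagOf x i.succ = flagOf x i.castSucc ⊔ rightSpan {x i} := by
  rw [flagOf, setOf_lt_succ, Set.image_insert_eq, Set.insert_eq, sup_comm]
  exact Submodule.span_union _ _

theorem flagOf_strictMono {x : Fin n → R} (hx : ∀ i, x i ∉ flagOf x i.castSucc) :
    StrictMono (flagOf x) := by
  refine Fin.strictMono_iff_lt_succ.mpr fun i => ?_
  rw [flagOf_succ, left_lt_sup, Submodule.span_singleton_le_iff_mem]
  exact hx i

theorem isGroebnerFlag_flagOf {𝒜 : ℕ → Submodule k R} {x : Fin n → R}
    (hbasis : IsDegreeOneBasis 𝒜 x) (hlast : augmentationIdeal 𝒜 = rightSpan (Set.range x))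
    (hmem : ∀ i, x i ∉ flagOf x i.castSucc)
    (hcolon : ∀ i, rightColon (x i) (flagOf x i.castSucc) ∈ Set.range (flagOf x)) :
    IsGroebnerFlag 𝒜 (flagOf x) := by
  have hdeg : ∀ i, x i ∈ 𝒜 1 := fun i => hbasis.2 ▸ Submodule.subset_span (Set.mem_range_self i)
  have hmono := flagOf_strictMono hmem
  refine
    { finrank_eq := by rw [← hbasis.2, finrank_span_eq_card hbasis.1, Fintype.card_fin]
      strictMono := hmono
      zero_eq := flagOf_zero x
      last_eq := (flagOf_last x).trans hlast.symm
      isKoszulFiltration :=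
        { degree_one_generated := ?_
          bot_mem := ⟨0, flagOf_zero x⟩
          augmentation_mem := ⟨Fin.last n, (flagOf_last x).trans hlast.symm⟩
          step := ?_ } }
  · rintro _ ⟨i, rfl⟩
    exact ⟨_, Set.image_subset_iff.mpr fun j _ => hdeg j, rfl⟩
  · rintro _ ⟨i, rfl⟩ hi
    have hi0 : i ≠ 0 := by rintro rfl; exact hi (flagOf_zero x)
    obtain ⟨i, rfl⟩ := Fin.exists_succ_eq.mpr hi0
    exact ⟨_, ⟨i.castSucc, rfl⟩, (hmono i.castSucc_lt_succ).ne', x i, hdeg i, flagOf_succ x i,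
      hcolon i⟩

end Flag

section Grading

variable {k R : Type*} [CommRing k] [Ring R] [Algebra k R]

open scoped DirectSum

theorem isInternal_pow_span_of_algHom {S : Set R} (hS : Algebra.adjoin k S = ⊤)
    (f : R →ₐ[k] ⨁ i, ↥(Submodule.span k S ^ i))
    (hf : ∀ s (hs : s ∈ Submodule.span k S ^ 1), s ∈ S →
      f s = DirectSum.of (fun i => ↥(Submodule.span k S ^ i)) 1 ⟨s, hs⟩) :
    DirectSum.IsInternal (fun i => Submodule.span k S ^ i) := by
  have hright : (DirectSum.coeAlgHom fun i => Submodule.span k S ^ i).comp f = AlgHom.id k R :=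
    AlgHom.ext_of_adjoin_eq_top hS fun s hs => by
      have hs' : s ∈ Submodule.span k S ^ 1 := by
        rw [pow_one]; exact Submodule.subset_span hs
      rw [AlgHom.comp_apply, hf s hs' hs, DirectSum.coeAlgHom_of, AlgHom.id_apply]
  have hone (v : R) (hv : v ∈ Submodule.span k S) (hv' : v ∈ Submodule.span k S ^ 1) :
      f v = DirectSum.of (fun i => ↥(Submodule.span k S ^ i)) 1 ⟨v, hv'⟩ := by
    induction hv using Submodule.span_induction with
    | mem s hs => exact hf s hv' hs
    | zero => rw [map_zero]; exact (map_zero _).symm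
    | add a b ha hb iha ihb =>
      rw [map_add, iha (by rwa [pow_one]), ihb (by rwa [pow_one]), ← map_add]; rfl
    | smul c a ha ih =>
      rw [map_smul, ih (by rwa [pow_one]), ← DirectSum.lof_eq_of k, ← map_smul]; rfl
  have hleft (i : ℕ) (a : ↥(Submodule.span k S ^ i)) : f a = DirectSum.of _ i a := by
    obtain ⟨a, ha⟩ := a
    induction ha using Submodule.pow_induction_on_left' with
    | algebraMap r => exact f.commutes r
    | add a b i _ _ iha ihb => rw [map_add, iha, ihb, ← map_add]; rfl
    | mem_mul v hv i a _ ih =>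
      rw [map_mul, ih, hone v hv (by rwa [pow_one]), DirectSum.of_mul_of]
      exact DirectSum.of_eq_of_gradedMonoid_eq (Sigma.subtype_ext (add_comm _ _) rfl)
  let := GradedAlgebra.ofAlgHom (fun i => Submodule.span k S ^ i) f hright hleft
  exact DirectSum.Decomposition.isInternal _

end Grading

section ColorPolynomial

universe v

/-- The commutation relations `xᵢ xⱼ = qᵢⱼ xⱼ xᵢ` for a family `x` of elements of an algebra. -/
def QCommute {k R ι : Type*} [CommRing k] [Ring R] [Algebra k R] (q : ι → ι → k) (x : ι → R) :
    Prop :=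
  ∀ i j, x i * x j = q i j • (x j * x i)

/-- `R` is the color polynomial algebra on the generators `x`: the algebra presented by the
relations `xᵢ xⱼ = qᵢⱼ xⱼ xᵢ`, where `qᵢⱼ qⱼᵢ = 1` for `i ≠ j`. The universal property is only
required for algebras in the universe of `R`. There is no condition on `qᵢᵢ`: if `1 - qᵢᵢ` is
invertible, then the relation says that `xᵢ² = 0`. -/
structure IsColorPolynomial {k ι : Type*} {R : Type v} [CommRing k] [Ring R] [Algebra k R]
    (q : ι → ι → k) (x : ι → R) : Prop where
  mul_swap : ∀ ⦃i j⦄, i ≠ j → q i j * q j i = 1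
  qCommute : QCommute q x
  adjoin_eq_top : Algebra.adjoin k (Set.range x) = ⊤
  exists_lift : ∀ {B : Type v} [Ring B] [Algebra k B] (y : ι → B), QCommute q y →
    ∃ f : R →ₐ[k] B, ∀ i, f (x i) = y i

namespace IsColorPolynomial

section CommRing

variable {k ι : Type*} {R : Type v} [CommRing k] [Ring R] [Algebra k R]
  {q : ι → ι → k} {x : ι → R}

@[elab_as_elim]
theorem induction (h : IsColorPolynomial q x) {C : R → Prop}
    (algebraMap : ∀ c, C (algebraMap k R c)) (gen : ∀ i, C (x i))
    (add : ∀ a b, C a → C b → C (a + b)) (mul : ∀ a b, C a → C b → C (a * b)) (a : R) : C a := by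
  have ha : a ∈ Algebra.adjoin k (Set.range x) := h.adjoin_eq_top ▸ Algebra.mem_top
  induction ha using Algebra.adjoin_induction with
  | mem _ hx => obtain ⟨i, rfl⟩ := hx; exact gen i
  | algebraMap c => exact algebraMap c
  | add a b _ _ ha hb => exact add a b ha hb
  | mul a b _ _ ha hb => exact mul a b ha hb

theorem mul_mem_rightSpan_image (h : IsColorPolynomial q x) {Y : Set ι} (r : R) {a : R}
    (ha : a ∈ rightSpan (x '' Y)) : r * a ∈ rightSpan (x '' Y) := by
  induction r using h.induction generalizing a with
  | algebraMap c => rw [Algebra.commutes]; exact RightIdeal.mul_mem_right ha _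
  | gen i =>
    suffices hle : rightSpan (x '' Y) ≤ rightColon (x i) (rightSpan (x '' Y)) from hle ha
    rw [Submodule.span_le]
    rintro _ ⟨y, hy, rfl⟩
    rw [SetLike.mem_coe, mem_rightColon, h.qCommute]
    exact RightIdeal.algebra_smul_mem _
      (RightIdeal.mul_mem_right (Submodule.subset_span (Set.mem_image_of_mem x hy)) _)
  | add r s hr hs => rw [add_mul]; exact add_mem (hr ha) (hs ha)
  | mul r s hr hs => rw [mul_assoc]; exact hr (hs ha)

section Retraction

open Classical in
theorem exists_retraction (h : IsColorPolynomial q x) (Y : Set ι) :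
    ∃ π : R →ₐ[k] R, ∀ i, π (x i) = if i ∈ Y then 0 else x i := by
  refine h.exists_lift _ fun i j => ?_
  by_cases hi : i ∈ Y
  · simp [hi]
  by_cases hj : j ∈ Y
  · simp [hj]
  · simpa only [hi, hj, if_false] using h.qCommute i j

/-- The endomorphism that kills the generators in `Y` and fixes the others. -/
noncomputable def retraction (h : IsColorPolynomial q x) (Y : Set ι) : R →ₐ[k] R :=
  (h.exists_retraction Y).choose

variable (h : IsColorPolynomial q x) {Y : Set ι} {i j : ι}

include h

theorem retraction_gen_of_mem (hi : i ∈ Y) : h.retraction Y (x i) = 0 := by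
  rw [retraction, (h.exists_retraction Y).choose_spec, if_pos hi]

theorem retraction_gen_of_notMem (hi : i ∉ Y) : h.retraction Y (x i) = x i := by
  rw [retraction, (h.exists_retraction Y).choose_spec, if_neg hi]

theorem sub_retraction_mem (Y : Set ι) (a : R) : a - h.retraction Y a ∈ rightSpan (x '' Y) := by
  induction a using h.induction with
  | algebraMap c => rw [AlgHom.commutes, sub_self]; exact zero_mem _
  | gen i =>
    by_cases hi : i ∈ Y
    · rw [h.retraction_gen_of_mem hi, sub_zero]
      exact Submodule.subset_span (Set.mem_image_of_mem x hi)
    · rw [h.retraction_gen_of_notMem hi, sub_self]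
      exact zero_mem _
  | add a b ha hb => rw [map_add, add_sub_add_comm]; exact add_mem ha hb
  | mul a b ha hb =>
    have hab : a * b - h.retraction Y (a * b) =
        (a - h.retraction Y a) * b + h.retraction Y a * (b - h.retraction Y b) := by
      rw [map_mul]; noncomm_ring
    rw [hab]
    exact add_mem (RightIdeal.mul_mem_right ha b) (h.mul_mem_rightSpan_image _ hb)

theorem mem_rightSpan_image_iff {a : R} : a ∈ rightSpan (x '' Y) ↔ h.retraction Y a = 0 := by
  refine ⟨fun ha => ?_, fun ha => by simpa only [ha, sub_zero] using h.sub_retraction_mem Y a⟩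
  induction ha using Submodule.span_induction with
  | mem _ hs => obtain ⟨i, hi, rfl⟩ := hs; exact h.retraction_gen_of_mem hi
  | zero => exact map_zero _
  | add a b _ _ ha hb => rw [map_add, ha, hb, add_zero]
  | smul c a _ ha => rw [MulOpposite.smul_eq_mul_unop, map_mul, ha, zero_mul]

theorem mul_mem_rightSpan_image_iff (hj : j ∉ Y) {a : R} :
    x j * a ∈ rightSpan (x '' Y) ↔ x j * h.retraction Y a = 0 := by
  rw [h.mem_rightSpan_image_iff, map_mul, h.retraction_gen_of_notMem hj]

end Retraction

section SkewDerivation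

variable [DecidableEq ι]

/-- The matrices `[xᵢ, 0; δᵢⱼ, tᵢ xᵢ]`, where `tᵢ = qᵢⱼ` for `i ≠ j` and `tⱼ = c`. An algebra
homomorphism sending `xᵢ` to these has as its lower left entry a skew derivation dual to `xⱼ`. -/
def skewMatrix (q : ι → ι → k) (x : ι → R) (j : ι) (c : k) (i : ι) : Matrix (Fin 2) (Fin 2) R :=
  !![x i, 0; if i = j then 1 else 0, (if i = j then c else q i j) • x i]

theorem qCommute_skewMatrix (h : IsColorPolynomial q x) (j : ι) {c : k}
    (hc : (1 - q j j) * (1 + c) = 0) : QCommute q (skewMatrix q x j c) := by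
  have hdiag : 1 + c = q j j * (1 + c) := by linear_combination hc
  have hentry (i l : ι) :
      (if i = j then (1 : R) else 0) * x l +
          ((if i = j then c else q i j) • x i) * (if l = j then 1 else 0) =
        q i l • ((if l = j then (1 : R) else 0) * x i +
          ((if l = j then c else q l j) • x l) * (if i = j then 1 else 0)) := by
    by_cases hi : i = j <;> by_cases hl : l = j
    · subst hi hl
      simpa [add_smul, smul_smul, mul_add] using congr($hdiag • x l)
    · subst hi
      simp [hl, smul_smul, h.mul_swap (Ne.symm hl)]
    · subst hl
      simp [hi]
    · simp [hi, hl]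
  intro i l
  have hil := h.qCommute i l
  simp only [skewMatrix, Matrix.mul_fin_two, Matrix.smul_of, Matrix.smul_cons, Matrix.smul_empty,
    hentry i l, mul_zero, zero_mul, add_zero, zero_add, smul_zero, hil, smul_mul_smul_comm,
    smul_comm (q i l), mul_comm (if i = j then c else q i j)]

theorem apply_zero_of_gen_eq_skewMatrix (h : IsColorPolynomial q x) {j : ι} {c : k}
    {Φ : R →ₐ[k] Matrix (Fin 2) (Fin 2) R} (hΦ : ∀ i, Φ (x i) = skewMatrix q x j c i) (b : R) :
    Φ b 0 0 = b ∧ Φ b 0 1 = 0 := by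
  induction b using h.induction with
  | algebraMap r => simp [Matrix.algebraMap_matrix_apply]
  | gen i => simp [hΦ, skewMatrix]
  | add a b ha hb => simp [ha, hb]
  | mul a b ha hb => simp [Matrix.mul_apply, ha, hb]

end SkewDerivation

/- For `qⱼⱼ = 1` the choice `c = 0` makes `D` division by `xⱼ`; `c = 1` would give the partial
derivative, which does not detect that `xⱼ` is regular in positive characteristic. -/
theorem exists_skewDerivation (h : IsColorPolynomial q x) (j : ι) {c : k}
    (hc : (1 - q j j) * (1 + c) = 0) :
    ∃ D : R →ₗ[k] R, ∀ b, D (x j * b) = b + c • (x j * D b) := by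
  classical
  obtain ⟨Φ, hΦ⟩ := h.exists_lift _ (h.qCommute_skewMatrix j hc)
  have hmul (b : R) : Φ (x j * b) 1 0 = b + c • (x j * Φ b 1 0) := by
    rw [map_mul, hΦ, Matrix.mul_apply, Fin.sum_univ_two,
      (h.apply_zero_of_gen_eq_skewMatrix hΦ b).1]
    simp [skewMatrix]
  exact ⟨Matrix.entryLinearMap k R 1 0 ∘ₗ Φ.toLinearMap, hmul⟩

theorem gen_ne_zero [Nontrivial R] (h : IsColorPolynomial q x) (j : ι) : x j ≠ 0 := by
  intro hj
  obtain ⟨D, hD⟩ := h.exists_skewDerivation j (c := -1) (by ring)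
  simpa [hj] using hD 1

theorem gen_notMem_rightSpan_image [Nontrivial R] (h : IsColorPolynomial q x) {Y : Set ι} {j : ι}
    (hj : j ∉ Y) : x j ∉ rightSpan (x '' Y) := by
  rw [h.mem_rightSpan_image_iff, h.retraction_gen_of_notMem hj]
  exact h.gen_ne_zero j

theorem eq_zero_of_gen_mul_eq_zero (h : IsColorPolynomial q x) {j : ι} (hj : q j j = 1) {b : R}
    (hb : x j * b = 0) : b = 0 := by
  obtain ⟨D, hD⟩ := h.exists_skewDerivation j (c := 0) (by rw [hj, sub_self, zero_mul])
  simpa [hb] using (hD b).symm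

theorem exists_eq_gen_mul_of_gen_mul_eq_zero (h : IsColorPolynomial q x) {j : ι} {b : R}
    (hb : x j * b = 0) : ∃ b', b = x j * b' := by
  obtain ⟨D, hD⟩ := h.exists_skewDerivation j (c := -1) (by ring)
  refine ⟨D b, ?_⟩
  simpa [hb, ← sub_eq_add_neg, sub_eq_zero] using (hD b).symm

theorem gen_mul_self_eq_zero (h : IsColorPolynomial q x) {j : ι} (hj : IsUnit (1 - q j j)) :
    x j * x j = 0 := by
  rw [← hj.smul_eq_zero, sub_smul, one_smul, sub_eq_zero]
  exact h.qCommute j j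

theorem rightColon_gen_of_eq_one (h : IsColorPolynomial q x) {Y : Set ι} {j : ι} (hjY : j ∉ Y)
    (hj : q j j = 1) : rightColon (x j) (rightSpan (x '' Y)) = rightSpan (x '' Y) := by
  ext a
  refine ⟨fun ha => ?_, h.mul_mem_rightSpan_image _⟩
  rw [mem_rightColon, h.mul_mem_rightSpan_image_iff hjY] at ha
  exact h.mem_rightSpan_image_iff.mpr (h.eq_zero_of_gen_mul_eq_zero hj ha)

theorem rightColon_gen_of_isUnit (h : IsColorPolynomial q x) {Y : Set ι} {j : ι} (hjY : j ∉ Y)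
    (hj : IsUnit (1 - q j j)) :
    rightColon (x j) (rightSpan (x '' Y)) = rightSpan (x '' insert j Y) := by
  apply le_antisymm
  · intro a ha
    rw [mem_rightColon, h.mul_mem_rightSpan_image_iff hjY] at ha
    obtain ⟨b, hb⟩ := h.exists_eq_gen_mul_of_gen_mul_eq_zero ha
    rw [← sub_add_cancel a (h.retraction Y a), hb]
    refine add_mem ?_ (RightIdeal.mul_mem_right (Submodule.subset_span ?_) b)
    · rw [← hb]
      exact Submodule.span_mono (Set.image_mono (Set.subset_insert j Y)) (h.sub_retraction_mem Y a)
    · exact Set.mem_image_of_mem x (Set.mem_insert j Y)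
  · rw [Submodule.span_le, Set.image_insert_eq, Set.insert_subset_iff]
    refine ⟨?_, fun a ha => h.mul_mem_rightSpan_image _ (Submodule.subset_span ha)⟩
    rw [SetLike.mem_coe, mem_rightColon, h.gen_mul_self_eq_zero hj]
    exact zero_mem _

open scoped DirectSum in
theorem isInternal_pow_span (h : IsColorPolynomial q x) :
    DirectSum.IsInternal (fun i => Submodule.span k (Set.range x) ^ i) := by
  have hx (i : ι) : x i ∈ Submodule.span k (Set.range x) ^ 1 := by
    rw [pow_one]; exact Submodule.subset_span (Set.mem_range_self i)
  obtain ⟨f, hf⟩ := h.exists_lift (B := ⨁ i, ↥(Submodule.span k (Set.range x) ^ i))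
    (fun i => DirectSum.of _ 1 ⟨x i, hx i⟩) fun i j => by
      rw [DirectSum.of_mul_of, DirectSum.of_mul_of, ← DirectSum.lof_eq_of k,
        ← DirectSum.lof_eq_of k, ← map_smul]
      exact congrArg _ (Subtype.ext (h.qCommute i j))
  refine isInternal_pow_span_of_algHom h.adjoin_eq_top f ?_
  rintro _ hs ⟨i, rfl⟩
  exact hf i

end CommRing

section Field

variable {k ι : Type*} {R : Type v} [Field k] [Ring R] [Algebra k R]

theorem rightColon_gen_eq_or {q : ι → ι → k} {x : ι → R} (h : IsColorPolynomial q x) {Y : Set ι}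
    {j : ι} (hjY : j ∉ Y) :
    rightColon (x j) (rightSpan (x '' Y)) = rightSpan (x '' Y) ∨
      rightColon (x j) (rightSpan (x '' Y)) = rightSpan (x '' insert j Y) := by
  by_cases hj : q j j = 1
  · exact Or.inl (h.rightColon_gen_of_eq_one hjY hj)
  · exact Or.inr (h.rightColon_gen_of_isUnit hjY (sub_ne_zero.mpr (Ne.symm hj)).isUnit)

theorem isStandardGraded [Nontrivial R] [Finite ι] {q : ι → ι → k} {x : ι → R}
    (h : IsColorPolynomial q x) :
    IsStandardGraded (fun i => Submodule.span k (Set.range x) ^ i) where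
  gradedMonoid := Submodule.nat_power_gradedMonoid _
  isInternal := h.isInternal_pow_span
  finite i := Module.Finite.iff_fg.mpr ((Submodule.fg_span (Set.finite_range x)).pow i)
  nontrivial := inferInstance
  zero_eq := by rw [pow_zero, Submodule.one_eq_range]
  adjoin_one := by rw [pow_one, Algebra.adjoin_span, h.adjoin_eq_top]

theorem linearIndependent [Nontrivial R] {q : ι → ι → k} {x : ι → R}
    (h : IsColorPolynomial q x) : LinearIndependent k x := by
  refine linearIndependent_iff_notMem_span.mpr fun j hj => ?_
  exact h.gen_notMem_rightSpan_image (by simp) (coe_span_subset_rightSpan _ hj)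

variable [Nontrivial R] {n : ℕ} {q : Fin n → Fin n → k} {x : Fin n → R}

theorem isDegreeOneBasis (h : IsColorPolynomial q x) :
    IsDegreeOneBasis (fun i => Submodule.span k (Set.range x) ^ i) x :=
  ⟨h.linearIndependent, (pow_one _).symm⟩

theorem isInitiallyKoszulWRT (h : IsColorPolynomial q x) :
    IsInitiallyKoszulWRT (fun i => Submodule.span k (Set.range x) ^ i) x := by
  refine ⟨h.isStandardGraded, h.isDegreeOneBasis,
    isGroebnerFlag_flagOf h.isDegreeOneBasis (augmentationIdeal_pow_span _)
      (fun i => h.gen_notMem_rightSpan_image (by simp)) fun i => ?_⟩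
  rcases h.rightColon_gen_eq_or (Y := {j | (j : ℕ) < i.castSucc}) (j := i) (by simp) with hi | hi
  · exact ⟨i.castSucc, hi.symm⟩
  · exact ⟨i.succ, by rw [flagOf, setOf_lt_succ]; exact hi.symm⟩

theorem isStronglyKoszul (h : IsColorPolynomial q x) :
    IsStronglyKoszul (fun i => Submodule.span k (Set.range x) ^ i) :=
  ⟨h.isStandardGraded, n, x, h.isDegreeOneBasis, fun Y _ hj =>
    (h.rightColon_gen_eq_or hj).elim (fun hY => ⟨Y, hY⟩) fun hY => ⟨_, hY⟩⟩

end Field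

end IsColorPolynomial

end ColorPolynomial

namespace ColorLieAlgebra

variable {k Γ g : Type*} [Field k] [AddCommGroup Γ] {ε : CommutationFactor k Γ}
  [AddCommGroup g] [Module k g] {L : ColorLieAlgebra ε g}

theorem component_eq_span {ι : Type*} {x : ι → g} {d : ι → Γ} (hd : ∀ i, x i ∈ L.component (d i))
    (hx : Submodule.span k (Set.range x) = ⊤) (α : Γ) :
    L.component α = Submodule.span k (x '' {i | d i = α}) := by
  have hle : (fun α => Submodule.span k (x '' {i | d i = α})) ≤ L.component := by
    intro α
    rw [Submodule.span_le]
    rintro _ ⟨i, rfl, rfl⟩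
    exact hd i
  refine (congr_fun ((L.independent.le_iff_eq_of_iSup_eq_top ?_).mp hle) α).symm
  rw [← Submodule.span_iUnion, ← Set.image_iUnion, ← hx]
  congr
  ext; simp

/-- A linear map from `g` to an associative algebra satisfies the relations that define `U(g)`
for abelian `g`. -/
def ColorCommutes {B : Type*} [Ring B] [Algebra k B] (L : ColorLieAlgebra ε g) (φ : g →ₗ[k] B) :
    Prop :=
  ∀ α β, ∀ a ∈ L.component α, ∀ b ∈ L.component β, φ a * φ b = (ε α β : k) • (φ b * φ a)

theorem colorCommutes_of_qCommute {B ι : Type*} [Ring B] [Algebra k B] {x : ι → g} {d : ι → Γ}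
    (hd : ∀ i, x i ∈ L.component (d i)) (hx : Submodule.span k (Set.range x) = ⊤) {φ : g →ₗ[k] B}
    (hφ : QCommute (fun i j => (ε (d i) (d j) : k)) fun i => φ (x i)) : L.ColorCommutes φ := by
  intro α β a ha b hb
  rw [component_eq_span hd hx] at ha hb
  induction ha, hb using Submodule.span_induction₂ with
  | mem_mem _ _ ha hb =>
    obtain ⟨i, rfl, rfl⟩ := ha
    obtain ⟨j, rfl, rfl⟩ := hb
    exact hφ i j
  | zero_left => simp
  | zero_right => simp
  | add_left a a' b _ _ _ h h' => simp only [map_add, add_mul, mul_add, smul_add, h, h']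
  | add_right a b b' _ _ _ h h' => simp only [map_add, add_mul, mul_add, smul_add, h, h']
  | smul_left c a b _ _ h =>
    simp only [map_smul, smul_mul_assoc, mul_smul_comm, h, smul_comm c]
  | smul_right c a b _ _ h =>
    simp only [map_smul, smul_mul_assoc, mul_smul_comm, h, smul_comm c]

theorem colorCommutes_ι (hL : L.IsAbelian) : L.ColorCommutes L.ι := by
  intro α β a ha b hb
  have h := RingQuot.mkAlgHom_rel k (EnvelopingRel.bracket (L := L) α β a b ha hb)
  rw [hL a b, map_zero, map_zero, map_sub, map_smul, map_mul, map_mul, sub_eq_zero] at h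
  exact h

theorem ColorCommutes.exists_lift (hL : L.IsAbelian) {B : Type*} [Ring B] [Algebra k B]
    {φ : g →ₗ[k] B} (hφ : L.ColorCommutes φ) :
    ∃ f : L.Enveloping →ₐ[k] B, ∀ a, f (L.ι a) = φ a := by
  have hrel : ∀ ⦃s t⦄, L.EnvelopingRel s t →
      TensorAlgebra.lift k φ s = TensorAlgebra.lift k φ t := by
    rintro _ _ ⟨α, β, a, b, ha, hb⟩
    simp [hL a b, hφ α β a ha b hb]
  refine ⟨RingQuot.liftAlgHom k ⟨TensorAlgebra.lift k φ, hrel⟩, fun a => ?_⟩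
  exact (RingQuot.liftAlgHom_mkAlgHom_apply k _ hrel _).trans (TensorAlgebra.lift_ι_apply φ a)

theorem nontrivial_enveloping (hL : L.IsAbelian) : Nontrivial L.Enveloping := by
  have hzero : L.ColorCommutes (0 : g →ₗ[k] k) := fun α β a _ b _ => by simp
  obtain ⟨f, -⟩ := hzero.exists_lift hL
  exact f.toRingHom.domain_nontrivial

theorem span_range_ι_comp {ι : Type*} {x : ι → g} (hx : Submodule.span k (Set.range x) = ⊤) :
    Submodule.span k (Set.range fun i => L.ι (x i)) = LinearMap.range L.ι := by
  rw [LinearMap.range_eq_map, ← hx, Submodule.map_span, ← Set.range_comp]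
  rfl

theorem adjoin_range_ι : Algebra.adjoin k (Set.range L.ι) = ⊤ := by
  have hrange : Set.range L.ι =
      RingQuot.mkAlgHom k L.EnvelopingRel '' Set.range (TensorAlgebra.ι k) := by
    rw [← Set.range_comp]
    rfl
  rw [hrange, ← AlgHom.map_adjoin, TensorAlgebra.adjoin_range_ι, Algebra.map_top,
    AlgHom.range_eq_top]
  exact RingQuot.mkAlgHom_surjective k _

theorem isColorPolynomial_ι (hL : L.IsAbelian) {ι : Type*} (x : Module.Basis ι k g) {d : ι → Γ}
    (hd : ∀ i, x i ∈ L.component (d i)) :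
    IsColorPolynomial (fun i j => (ε (d i) (d j) : k)) (fun i => L.ι (x i)) where
  mul_swap i j _ := by rw [← Units.val_mul, ε.mul_swap, Units.val_one]
  qCommute i j := colorCommutes_ι hL _ _ _ (hd i) _ (hd j)
  adjoin_eq_top := by
    rw [← Algebra.adjoin_span, span_range_ι_comp x.span_eq]
    exact adjoin_range_ι
  exists_lift y hy := by
    have hφ : L.ColorCommutes (x.constr k y) :=
      colorCommutes_of_qCommute hd x.span_eq (by simpa only [Module.Basis.constr_basis] using hy)
    obtain ⟨f, hf⟩ := hφ.exists_lift hL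
    exact ⟨f, fun i => by rw [hf, Module.Basis.constr_basis]⟩

theorem degreePart_eq_span_pow {ι : Type*} {x : ι → g}
    (hx : Submodule.span k (Set.range x) = ⊤) :
    L.degreePart = fun i => Submodule.span k (Set.range fun i => L.ι (x i)) ^ i := by
  funext i
  rw [degreePart, span_range_ι_comp hx]

theorem isInitiallyKoszulWRT_degreePart (hL : L.IsAbelian) {n : ℕ} (x : Module.Basis (Fin n) k g)
    (hx : ∀ i, L.IsHomogeneous (x i)) : IsInitiallyKoszulWRT L.degreePart fun i => L.ι (x i) := by
  choose d hd using hx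
  have := nontrivial_enveloping hL
  rw [degreePart_eq_span_pow x.span_eq]
  exact (isColorPolynomial_ι hL x hd).isInitiallyKoszulWRT

theorem isStronglyKoszul_degreePart (hL : L.IsAbelian) {n : ℕ} (x : Module.Basis (Fin n) k g)
    (hx : ∀ i, L.IsHomogeneous (x i)) : IsStronglyKoszul L.degreePart := by
  choose d hd using hx
  have := nontrivial_enveloping hL
  rw [degreePart_eq_span_pow x.span_eq]
  exact (isColorPolynomial_ι hL x hd).isStronglyKoszul

theorem exists_homogeneous_basis [FiniteDimensional k g] {n : ℕ} (hn : Module.finrank k g = n) :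
    ∃ x : Module.Basis (Fin n) k g, ∀ i, L.IsHomogeneous (x i) := by
  classical
  have hI := DirectSum.isInternal_submodule_of_iSupIndep_of_iSup_eq_top L.independent L.iSup_eq_top
  let b := hI.collectedBasis fun γ => Module.Basis.ofVectorSpace k (L.component γ)
  have := Module.Finite.finite_basis b
  have := Fintype.ofFinite (Σ γ, Module.Basis.ofVectorSpaceIndex k (L.component γ))
  let e := Fintype.equivFinOfCardEq ((Module.finrank_eq_card_basis b).symm.trans hn)
  refine ⟨b.reindex e, fun i => ⟨(e.symm i).1, ?_⟩⟩
  rw [Module.Basis.reindex_apply]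
  exact hI.collectedBasis_mem _ _

end ColorLieAlgebra

end ColorKoszul

theorem mainTheorem8_general {k Γ g : Type*} [Field k]
    [AddCommGroup Γ] (ε : ColorKoszul.CommutationFactor k Γ)
    [AddCommGroup g] [Module k g] [FiniteDimensional k g]
    (L : ColorKoszul.ColorLieAlgebra ε g) (hL : L.IsAbelian)
    (n : ℕ) (hn : Module.finrank k g = n) :
    ColorKoszul.IsInitiallyKoszul L.degreePart ∧
    (∀ x : Fin n → g, (∀ i, L.IsHomogeneous (x i)) → Submodule.span k (Set.range x) = ⊤ →
      ColorKoszul.IsInitiallyKoszulWRT L.degreePart (fun i => L.ι (x i))) ∧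
    ColorKoszul.IsStronglyKoszul L.degreePart := by
  obtain ⟨x, hx⟩ := L.exists_homogeneous_basis hn
  refine ⟨?_, fun y hy hspan => ?_, L.isStronglyKoszul_degreePart hL x hx⟩
  · obtain ⟨hstandard, -, hflag⟩ := L.isInitiallyKoszulWRT_degreePart hL x hx
    exact ⟨hstandard, n, _, hflag⟩
  · let b := basisOfTopLeSpanOfCardEqFinrank y hspan.ge (by rw [Fintype.card_fin, hn])
    have hb : ⇑b = y := coe_basisOfTopLeSpanOfCardEqFinrank _ _ _
    simpa only [hb] using L.isInitiallyKoszulWRT_degreePart hL b (by simpa only [hb] using hy)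

theorem mainTheorem8 {k Γ g : Type*} [Field k] (h2 : (2 : k) ≠ 0) (h3 : (3 : k) ≠ 0)
    [AddCommGroup Γ] (ε : ColorKoszul.CommutationFactor k Γ)
    [AddCommGroup g] [Module k g] [FiniteDimensional k g]
    (L : ColorKoszul.ColorLieAlgebra ε g) (hL : L.IsAbelian)
    (n : ℕ) (hn : Module.finrank k g = n) :
    ColorKoszul.IsInitiallyKoszul L.degreePart ∧
    (∀ x : Fin n → g, (∀ i, L.IsHomogeneous (x i)) → Submodule.span k (Set.range x) = ⊤ →
      ColorKoszul.IsInitiallyKoszulWRT L.degreePart (fun i => L.ι (x i))) ∧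
    ColorKoszul.IsStronglyKoszul L.degreePart :=
  mainTheorem8_general ε L hL n hn
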